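/- A De Morgan algebra is a bounded distributive lattice with a unary operation $\sim$ satisfying $\sim\sim x=x$ and $\sim(x\vee y)=\sim x\wedge\sim y$. A monadic De Morgan algebra is a De Morgan algebra with a unary operation $\nabla$ satisfying $\nabla 0=0$, $x\le\nabla x$, $\nabla(x\vee y)=\nabla x\vee\nabla y$, $\nabla(x\wedge\nabla y)=\nabla x\wedge\nabla y$ and $\nabla(\sim\nabla x)=\sim\nabla x$. Let $\mathcal M^{\nabla}$ be the variety of all monadic De Morgan algebras, and define subvarieties of it by the following additional equations (an inequality $s\le t$ stands for the equation $s\wedge t=s$): - $\mathcal B^{\nabla}$: $x\wedge\sim x=0$ and $x\vee\sim x=1$; - $\mathcal K^{\nabla}$: $x\wedge\sim x\le y\vee\sim y$; - $\mathcal M^{\nabla_0}$: $\nabla x\wedge\sim\nabla x=0$; - $\mathcal M^{\nabla_{01}}$: $\nabla x\wedge\sim\nabla x\le\nabla y\vee\sim\nabla y$; - $\mathcal M^{\nabla_2}$: $\nabla(x\wedge\sim x)\le\;\sim\nabla(x\wedge\sim x)$; - $\mathcal K^{\nabla_0}=\mathcal K^{\nabla}\cap\mathcal M^{\nabla_0}$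 and $\mathcal K^{\nabla_1}=\mathcal K^{\nabla}\cap\mathcal M^{\nabla_2}$. **Proposition.** The twelve varieties $$\mathcal B^{\nabla},\ \mathcal K^{\nabla_0},\ \mathcal K^{\nabla_1},\ \mathcal K^{\nabla},\ \mathcal M^{\nabla_0},\ \mathcal M^{\nabla_2},\ \mathcal M^{\nabla_0}\vee\mathcal K^{\nabla},\ \mathcal K^{\nabla}\vee\mathcal M^{\nabla_2},\ \mathcal M^{\nabla_{01}},\ \mathcal M^{\nabla_0}\vee\mathcal M^{\nabla_2},\ \mathcal M^{\nabla_{01}}\vee\mathcal M^{\nabla_2},\ \mathcal M^{\nabla}$$ are pairwise distinct and form a sublattice of the lattice of subvarieties of $\mathcal M^{\nabla}$ (ordered by inclusion; $\vee$ is the join in that lattice). The Hasse diagram of this sublattice has exactly the following sixteen edges, where $\mathcal V\prec\mathcal W$ means that $\mathcal W$ covers $\mathcal V$ within the sublattice: - $\mathcal B^{\nabla}\prec\mathcal K^{\nabla_0}$ and $\mathcal B^{\nabla}\prec\mathcal K^{\nabla_1}$; - $\mathcal K^{\nabla_0}\prec\mathcal M^{\nabla_0}$ and $\mathcal K^{\nabla_0}\prec\mathcal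 K^{\nabla}$; - $\mathcal K^{\nabla_1}\prec\mathcal K^{\nabla}$ and $\mathcal K^{\nabla_1}\prec\mathcal M^{\nabla_2}$; - $\mathcal M^{\nabla_0}\prec\mathcal M^{\nabla_0}\vee\mathcal K^{\nabla}$ and $\mathcal K^{\nabla}\prec\mathcal M^{\nabla_0}\vee\mathcal K^{\nabla}$; - $\mathcal K^{\nabla}\prec\mathcal K^{\nabla}\vee\mathcal M^{\nabla_2}$ and $\mathcal M^{\nabla_2}\prec\mathcal K^{\nabla}\vee\mathcal M^{\nabla_2}$; - $\mathcal M^{\nabla_0}\vee\mathcal K^{\nabla}\prec\mathcal M^{\nabla_{01}}$ and $\mathcal M^{\nabla_0}\vee\mathcal K^{\nabla}\prec\mathcal M^{\nabla_0}\vee\mathcal M^{\nabla_2}$; - $\mathcal K^{\nabla}\vee\mathcal M^{\nabla_2}\prec\mathcal M^{\nabla_0}\vee\mathcal M^{\nabla_2}$; - $\mathcal M^{\nabla_{01}}\prec\mathcal M^{\nabla_{01}}\vee\mathcal M^{\nabla_2}$ and $\mathcal M^{\nabla_0}\vee\mathcal M^{\nabla_2}\prec\mathcal M^{\nabla_{01}}\vee\mathcal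 M^{\nabla_2}$; - $\mathcal M^{\nabla_{01}}\vee\mathcal M^{\nabla_2}\prec\mathcal M^{\nabla}$. In particular, the inclusions among the twelve varieties are exactly those obtained by following edges upwards, and every edge is a strict inclusion. -/

import Mathlib

universe u

namespace MonadicDeMorgan

/-- A De Morgan algebra: a bounded distributive lattice (possibly with one element) with a unary
operation satisfying `∼∼x = x` and `∼(x ∨ y) = ∼x ∧ ∼y`. -/
class DeMorganAlgebra (A : Type u) extends DistribLattice A, BoundedOrder A where
  neg : A → A
  neg_neg : ∀ x, neg (neg x) = x
  neg_sup : ∀ x y, neg (x ⊔ y) = neg x ⊓ neg y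

/-- A monadic De Morgan algebra: a De Morgan algebra with an existential quantifier `∇`. -/
class MonadicDeMorganAlgebra (A : Type u) extends DeMorganAlgebra A where
  nabla : A → A
  nabla_bot : nabla ⊥ = ⊥
  le_nabla : ∀ x, x ≤ nabla x
  nabla_sup : ∀ x y, nabla (x ⊔ y) = nabla x ⊔ nabla y
  nabla_inf_nabla : ∀ x y, nabla (x ⊓ nabla y) = nabla x ⊓ nabla y
  nabla_neg_nabla : ∀ x, nabla (neg (nabla x)) = neg (nabla x)

/-- Bundled monadic De Morgan algebras. -/
structure Alg : Type (u + 1) where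
  carrier : Type u
  [str : MonadicDeMorganAlgebra carrier]

attribute [instance] Alg.str

/-- Terms in the signature `0, 1, ∼, ∨, ∧, ∇` over the variables `x₀, x₁, …`. -/
inductive Term : Type
  | var : ℕ → Term
  | zero : Term
  | one : Term
  | neg : Term → Term
  | sup : Term → Term → Term
  | inf : Term → Term → Term
  | nabla : Term → Term

/-- The value of a term in a monadic De Morgan algebra under an assignment of the variables. -/
def Term.eval {A : Type u} [MonadicDeMorganAlgebra A] (v : ℕ → A) : Term → A
  | .var n => v n
  | .zero => ⊥
  | .one => ⊤
  | .neg t => DeMorganAlgebra.neg (t.eval v)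
  | .sup s t => s.eval v ⊔ t.eval v
  | .inf s t => s.eval v ⊓ t.eval v
  | .nabla t => MonadicDeMorganAlgebra.nabla (t.eval v)

/-- A formal equation `lhs = rhs` between two terms. -/
structure Equation : Type where
  lhs : Term
  rhs : Term

/-- The equation `s ∧ t = s`, which expresses `s ≤ t`. -/
def Term.leEq (s t : Term) : Equation := ⟨.inf s t, s⟩

/-- An algebra satisfies an equation if both sides agree under every assignment. -/
def Alg.Satisfies (A : Alg.{u}) (e : Equation) : Prop :=
  ∀ v : ℕ → A.carrier, e.lhs.eval v = e.rhs.eval v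

/-- The class of all monadic De Morgan algebras that satisfy every equation in `E`. -/
def models (E : Set Equation) : Set Alg.{u} := {A | ∀ e ∈ E, A.Satisfies e}

/-- A subvariety of the variety of monadic De Morgan algebras: a class of monadic De Morgan
algebras that is axiomatized, among them, by a set of equations. -/
@[ext]
structure Subvariety : Type (u + 1) where
  members : Set Alg.{u}
  equational : ∃ E : Set Equation, members = models E

namespace Subvariety

/-- Subvarieties are ordered by inclusion. -/
instance : PartialOrder Subvariety.{u} :=
  PartialOrder.lift members fun _ _ h => Subvariety.ext h

/-- An intersection of subvarieties is a subvariety. -/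
instance : InfSet Subvariety.{u} where
  sInf S :=
    { members := {A | ∀ V ∈ S, A ∈ V.members}
      equational := by
        refine ⟨{e | ∃ V ∈ S, ∀ A ∈ V.members, A.Satisfies e}, ?_⟩
        ext A
        constructor
        · rintro hA e ⟨V, hV, he⟩
          exact he A (hA V hV)
        · intro hA V hV
          obtain ⟨E, hE⟩ := V.equational
          rw [hE]
          intro e he
          refine hA e ⟨V, hV, fun B hB => ?_⟩
          rw [hE] at hB
          exact hB e he }

theorem isGLB_sInf (S : Set Subvariety.{u}) : IsGLB S (sInf S) :=
  ⟨fun V hV _ hA => hA V hV, fun _ hW _ hA _ hV => hW hV hA⟩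

/-- The lattice of subvarieties, ordered by inclusion. Meets are intersections, and the join of two
subvarieties is the least subvariety that contains both. -/
instance : CompleteLattice Subvariety.{u} := completeLatticeOfInf _ isGLB_sInf

end Subvariety

/-- The subvariety axiomatized by `E`. -/
def ofEquations (E : Set Equation) : Subvariety.{u} := ⟨models E, E, rfl⟩

section Equations

/-- `x ∧ ∼x = 0`. -/
def eqInfCompl : Equation := ⟨.inf (.var 0) (.neg (.var 0)), .zero⟩

/-- `x ∨ ∼x = 1`. -/
def eqSupCompl : Equation := ⟨.sup (.var 0) (.neg (.var 0)), .one⟩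

/-- `x ∧ ∼x ≤ y ∨ ∼y`. -/
def eqKleene : Equation :=
  Term.leEq (.inf (.var 0) (.neg (.var 0))) (.sup (.var 1) (.neg (.var 1)))

/-- `∇x ∧ ∼∇x = 0`. -/
def eqZero : Equation := ⟨.inf (.nabla (.var 0)) (.neg (.nabla (.var 0))), .zero⟩

/-- `∇x ∧ ∼∇x ≤ ∇y ∨ ∼∇y`. -/
def eqZeroOne : Equation :=
  Term.leEq (.inf (.nabla (.var 0)) (.neg (.nabla (.var 0))))
    (.sup (.nabla (.var 1)) (.neg (.nabla (.var 1))))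

/-- `∇(x ∧ ∼x) ≤ ∼∇(x ∧ ∼x)`. -/
def eqTwo : Equation :=
  Term.leEq (.nabla (.inf (.var 0) (.neg (.var 0))))
    (.neg (.nabla (.inf (.var 0) (.neg (.var 0)))))

end Equations

/-- All monadic De Morgan algebras. -/
def varM : Subvariety.{u} := ofEquations ∅

/-- Monadic Boolean algebras. -/
def varB : Subvariety.{u} := ofEquations {eqInfCompl, eqSupCompl}

/-- Monadic Kleene algebras. -/
def varK : Subvariety.{u} := ofEquations {eqKleene}

/-- Monadic Kleene algebras with `∇x ∧ ∼∇x = 0`. -/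
def varK0 : Subvariety.{u} := ofEquations {eqKleene, eqZero}

/-- Monadic Kleene algebras with `∇(x ∧ ∼x) ≤ ∼∇(x ∧ ∼x)`. -/
def varK1 : Subvariety.{u} := ofEquations {eqKleene, eqTwo}

/-- Monadic De Morgan algebras with `∇x ∧ ∼∇x = 0`. -/
def varM0 : Subvariety.{u} := ofEquations {eqZero}

/-- Monadic De Morgan algebras with `∇x ∧ ∼∇x ≤ ∇y ∨ ∼∇y`. -/
def varM01 : Subvariety.{u} := ofEquations {eqZeroOne}

/-- Monadic De Morgan algebras with `∇(x ∧ ∼x) ≤ ∼∇(x ∧ ∼x)`. -/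
def varM2 : Subvariety.{u} := ofEquations {eqTwo}

/-- The twelve nodes of the diagram. -/
inductive Node : Type
  | B | K0 | K1 | K | M0 | M2 | M0K | KM2 | M01 | M0M2 | M01M2 | M

/-- The variety that labels a node; `⊔` is the join in the lattice of subvarieties. -/
def label : Node → Subvariety.{u}
  | .B => varB
  | .K0 => varK0
  | .K1 => varK1
  | .K => varK
  | .M0 => varM0
  | .M2 => varM2
  | .M0K => varM0 ⊔ varK
  | .KM2 => varK ⊔ varM2
  | .M01 => varM01
  | .M0M2 => varM0 ⊔ varM2
  | .M01M2 => varM01 ⊔ varM2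
  | .M => varM

/-- The sixteen line segments of the diagram; `Edge i j` says that a segment is drawn from `i` up
to `j`. -/
inductive Edge : Node → Node → Prop
  | B_K0 : Edge .B .K0
  | B_K1 : Edge .B .K1
  | K0_M0 : Edge .K0 .M0
  | K0_K : Edge .K0 .K
  | K1_K : Edge .K1 .K
  | K1_M2 : Edge .K1 .M2
  | M0_M0K : Edge .M0 .M0K
  | K_M0K : Edge .K .M0K
  | K_KM2 : Edge .K .KM2
  | M2_KM2 : Edge .M2 .KM2
  | M0K_M01 : Edge .M0K .M01
  | M0K_M0M2 : Edge .M0K .M0M2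
  | KM2_M0M2 : Edge .KM2 .M0M2
  | M01_M01M2 : Edge .M01 .M01M2
  | M0M2_M01M2 : Edge .M0M2 .M01M2
  | M01M2_M : Edge .M01M2 .M

end MonadicDeMorgan

/-! Call the values of ∇ closed. A prime filter F and its dual {x : ∼x ∉ F} define a congruence: x
and y are identified when, at each of the two points, they agree after truncation to an interval
between closed elements that the point separates. In the quotient, the induced point and its dual
separate the closed elements; such an algebra is local. A failing equation still fails in some
localization, so a subvariety is determined by its local members (`Subvariety.le_of_local`).

In a local algebra a closed z with z ≰ ∼z equals 1, so outside M2 some x has ∇(x ∧ ∼x) = 1.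
Relativizing equations to ∇(x ∧ ∼x) shows that every local member of V ∨ M2 lies in V or in M2
(`mem_or_mem_of_mem_sup_varM2`). Since M0 ∨ K lies inside both M01 and M0 ∨ M2, and M01 ∩ M2 ⊆ K,
local members of M0 ∨ K split in the same way.

On local algebras all twelve varieties are therefore decided by membership in M0, M01, K and M2.
Four implications leave seven patterns, all realized by explicit local algebras. The twelve
varieties thus correspond to twelve sets of patterns, closed under union and intersection, and the
diagram becomes a finite check. -/

namespace MonadicDeMorgan

local prefix:max "∼" => DeMorganAlgebra.neg
local prefix:max "∇" => MonadicDeMorganAlgebra.nabla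

/-! ### Elementary identities for ∼ and ∇ -/

section Basic

theorem compl_compl' {A : Type u} [DeMorganAlgebra A] (x : A) : ∼∼x = x :=
  DeMorganAlgebra.neg_neg x

theorem compl_sup' {A : Type u} [DeMorganAlgebra A] (x y : A) : ∼(x ⊔ y) = ∼x ⊓ ∼y :=
  DeMorganAlgebra.neg_sup x y

theorem compl_inf' {A : Type u} [DeMorganAlgebra A] (x y : A) : ∼(x ⊓ y) = ∼x ⊔ ∼y := by
  rw [← compl_compl' (∼x ⊔ ∼y), compl_sup', compl_compl', compl_compl']

theorem compl_antitone {A : Type u} [DeMorganAlgebra A] {x y : A} (h : x ≤ y) : ∼y ≤ ∼x := by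
  rw [← sup_eq_right.2 h, compl_sup']
  exact inf_le_left

theorem compl_bot' (A : Type u) [DeMorganAlgebra A] : ∼(⊥ : A) = ⊤ :=
  top_le_iff.1 (by simpa only [compl_compl'] using compl_antitone (bot_le : ⊥ ≤ ∼(⊤ : A)))

theorem compl_top' (A : Type u) [DeMorganAlgebra A] : ∼(⊤ : A) = ⊥ := by
  rw [← compl_bot', compl_compl']

variable {A : Type u} [MonadicDeMorganAlgebra A]

theorem nabla_top (A : Type u) [MonadicDeMorganAlgebra A] : ∇(⊤ : A) = ⊤ :=
  top_le_iff.1 (MonadicDeMorganAlgebra.le_nabla _)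

theorem nabla_nabla (x : A) : ∇∇x = ∇x := by
  simpa [nabla_top] using MonadicDeMorganAlgebra.nabla_inf_nabla ⊤ x

theorem nabla_mono {x y : A} (h : x ≤ y) : ∇x ≤ ∇y := by
  rw [← sup_eq_right.2 h, MonadicDeMorganAlgebra.nabla_sup]
  exact le_sup_left

theorem nabla_sup_compl_nabla (x : A) : ∇(∇x ⊔ ∼∇x) = ∇x ⊔ ∼∇x := by
  rw [MonadicDeMorganAlgebra.nabla_sup, nabla_nabla, MonadicDeMorganAlgebra.nabla_neg_nabla]

theorem nabla_nabla_inf_nabla (x y : A) : ∇(∇x ⊓ ∇y) = ∇x ⊓ ∇y := by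
  rw [MonadicDeMorganAlgebra.nabla_inf_nabla, nabla_nabla]

end Basic

/-! ### Prime filters and localization -/

/-- A point of a bounded lattice: the membership predicate of a prime filter. -/
@[ext]
structure Point (A : Type u) [Lattice A] [BoundedOrder A] where
  mem : A → Prop
  mem_top : mem ⊤
  not_mem_bot : ¬ mem ⊥
  mem_inf : ∀ x y, mem (x ⊓ y) ↔ mem x ∧ mem y
  mem_sup : ∀ x y, mem (x ⊔ y) ↔ mem x ∨ mem y

namespace Point

theorem exists_separating {A : Type u} [DistribLattice A] [BoundedOrder A] {x y : A}
    (h : ¬ x ≤ y) : ∃ F : Point A, F.mem x ∧ ¬ F.mem y := by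
  obtain ⟨J, hJ, hy, hx⟩ := DistribLattice.prime_ideal_of_disjoint_filter_ideal
    (F := Order.PFilter.principal x) (I := Order.Ideal.principal y) (by
      rw [Set.disjoint_left]
      intro z hz hz'
      exact h (le_trans (Order.PFilter.mem_principal.1 hz) (Order.Ideal.mem_principal.1 hz')))
  refine ⟨⟨fun z => z ∉ J, ?_, ?_, ?_, ?_⟩, ?_, ?_⟩
  · exact fun ht => hJ.toIsProper.ne_univ
      (Set.eq_univ_of_forall fun z => J.lower (le_top : z ≤ ⊤) ht)
  · exact fun hb => hb J.bot_mem
  · intro a b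
    rw [← not_or]
    refine not_congr ⟨fun hab => hJ.mem_or_mem hab, ?_⟩
    rintro (ha | hb)
    · exact J.lower inf_le_left ha
    · exact J.lower inf_le_right hb
  · intro a b
    rw [← not_and_or]
    exact not_congr Order.Ideal.sup_mem_iff
  · exact fun hxJ => Set.disjoint_left.1 hx (Order.PFilter.mem_principal.2 le_rfl) hxJ
  · exact fun hyJ => hyJ (hy (Order.Ideal.mem_principal.2 le_rfl))

theorem exists_ne {A : Type u} [DistribLattice A] [BoundedOrder A] {x y : A}
    (h : x ≠ y) : ∃ F : Point A, ¬ (F.mem x ↔ F.mem y) := by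
  by_cases hxy : x ≤ y
  · obtain ⟨F, hF⟩ := exists_separating fun hyx => h (le_antisymm hxy hyx)
    exact ⟨F, by tauto⟩
  · obtain ⟨F, hF⟩ := exists_separating hxy
    exact ⟨F, by tauto⟩

/-- The image of a point under the involution of the dual space. -/
def dual {A : Type u} [DeMorganAlgebra A] (F : Point A) : Point A where
  mem x := ¬ F.mem ∼x
  mem_top := by rw [compl_top']; exact F.not_mem_bot
  not_mem_bot := by rw [compl_bot']; exact not_not_intro F.mem_top
  mem_inf x y := by rw [compl_inf', F.mem_sup, not_or]
  mem_sup x y := by rw [compl_sup', F.mem_inf, not_and_or]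

theorem dual_dual {A : Type u} [DeMorganAlgebra A] (F : Point A) : F.dual.dual = F := by
  ext x
  simp only [dual, compl_compl', not_not]

variable {A : Type u} [MonadicDeMorganAlgebra A]

/-- Two elements agree locally at `F` if they agree between two closed elements that `F`
separates. -/
def Loc (F : Point A) (x y : A) : Prop :=
  ∃ p c, F.mem ∇p ∧ ¬ F.mem ∇c ∧ x ⊓ ∇p ⊔ ∇c = y ⊓ ∇p ⊔ ∇c

variable {F : Point A}

theorem Loc.mem_iff {x y : A} (h : F.Loc x y) : F.mem x ↔ F.mem y := by
  obtain ⟨p, c, hp, hc, h⟩ := h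
  have := congrArg F.mem h
  simp only [F.mem_sup, F.mem_inf, eq_iff_iff] at this
  tauto

theorem Loc.of_eq {x y : A} (h : x = y) : F.Loc x y :=
  ⟨⊤, ⊥, by rw [nabla_top]; exact F.mem_top,
    by rw [MonadicDeMorganAlgebra.nabla_bot]; exact F.not_mem_bot, by rw [h]⟩

theorem Loc.symm {x y : A} (h : F.Loc x y) : F.Loc y x := by
  obtain ⟨p, c, hp, hc, h⟩ := h
  exact ⟨p, c, hp, hc, h.symm⟩

/-- Agreement survives narrowing of the interval; this lets two local agreements share their bounds.
-/
theorem eq_of_eq_of_le {x y p c p' c' : A} (h : x ⊓ p ⊔ c = y ⊓ p ⊔ c) (hp : p' ≤ p)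
    (hc : c ≤ c') : x ⊓ p' ⊔ c' = y ⊓ p' ⊔ c' := by
  have key : ∀ z : A, z ⊓ p' ⊔ c' = (z ⊓ p ⊔ c) ⊓ p' ⊔ c' := fun z => by
    rw [inf_sup_right, inf_assoc, inf_eq_right.2 hp, sup_assoc,
      sup_eq_right.2 (inf_le_left.trans hc)]
  rw [key, h, ← key]

theorem Loc.common {x y x' y' : A} (h : F.Loc x y) (h' : F.Loc x' y') :
    ∃ p c, F.mem ∇p ∧ ¬ F.mem ∇c ∧ x ⊓ ∇p ⊔ ∇c = y ⊓ ∇p ⊔ ∇c ∧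
      x' ⊓ ∇p ⊔ ∇c = y' ⊓ ∇p ⊔ ∇c := by
  obtain ⟨p, c, hp, hc, h⟩ := h
  obtain ⟨p', c', hp', hc', h'⟩ := h'
  refine ⟨p ⊓ ∇p', c ⊔ c', ?_, ?_, ?_, ?_⟩
  · rw [MonadicDeMorganAlgebra.nabla_inf_nabla, F.mem_inf]
    exact ⟨hp, hp'⟩
  · rw [MonadicDeMorganAlgebra.nabla_sup, F.mem_sup]
    tauto
  · refine eq_of_eq_of_le h ?_ (nabla_mono le_sup_left)
    rw [MonadicDeMorganAlgebra.nabla_inf_nabla]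
    exact inf_le_left
  · refine eq_of_eq_of_le h' ?_ (nabla_mono le_sup_right)
    rw [MonadicDeMorganAlgebra.nabla_inf_nabla]
    exact inf_le_right

theorem Loc.trans {x y z : A} (h : F.Loc x y) (h' : F.Loc y z) : F.Loc x z := by
  obtain ⟨p, c, hp, hc, e, e'⟩ := h.common h'
  exact ⟨p, c, hp, hc, e.trans e'⟩

theorem Loc.inf {x y x' y' : A} (h : F.Loc x y) (h' : F.Loc x' y') :
    F.Loc (x ⊓ x') (y ⊓ y') := by
  obtain ⟨p, c, hp, hc, e, e'⟩ := h.common h'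
  refine ⟨p, c, hp, hc, ?_⟩
  rw [inf_inf_distrib_right, sup_inf_right, e, e', ← sup_inf_right, ← inf_inf_distrib_right]

theorem Loc.sup {x y x' y' : A} (h : F.Loc x y) (h' : F.Loc x' y') :
    F.Loc (x ⊔ x') (y ⊔ y') := by
  obtain ⟨p, c, hp, hc, e, e'⟩ := h.common h'
  refine ⟨p, c, hp, hc, ?_⟩
  rw [inf_sup_right, sup_sup_distrib_right, e, e', ← sup_sup_distrib_right, ← inf_sup_right]

/-- ∇ commutes with truncation by closed elements, by additivity and the law for ∇(x ∧ ∇y). -/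
theorem Loc.nabla {x y : A} (h : F.Loc x y) : F.Loc ∇x ∇y := by
  obtain ⟨p, c, hp, hc, e⟩ := h
  refine ⟨p, c, hp, hc, ?_⟩
  simpa only [MonadicDeMorganAlgebra.nabla_sup, MonadicDeMorganAlgebra.nabla_inf_nabla,
    nabla_nabla] using congrArg MonadicDeMorganAlgebra.nabla e

/-- Negation turns the bounds ∇c, ∇p into ∼∇p, ∼∇c, which are again closed and are separated by the
dual point. This is why the congruence must involve both points. -/
theorem Loc.compl {x y : A} (h : F.Loc x y) : F.dual.Loc ∼x ∼y := by
  obtain ⟨p, c, hp, hc, e⟩ := h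
  refine ⟨∼∇c, ∼∇p, ?_, ?_, ?_⟩
  · simpa only [dual, MonadicDeMorganAlgebra.nabla_neg_nabla, compl_compl'] using hc
  · simpa only [dual, MonadicDeMorganAlgebra.nabla_neg_nabla, compl_compl', not_not] using hp
  · simp only [MonadicDeMorganAlgebra.nabla_neg_nabla]
    have e' := congrArg DeMorganAlgebra.neg e
    simp only [compl_sup', compl_inf'] at e'
    -- Negating the agreement yields meet-of-joins truncations; joining with ∼∇p restores the form
    -- required by `Loc`.
    have key : ∀ z : A, z ⊓ ∼∇c ⊔ ∼∇p = (z ⊔ ∼∇p) ⊓ ∼∇c ⊔ ∼∇p := fun z => by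
      rw [inf_sup_right z, sup_assoc, sup_eq_right.2 (inf_le_left : ∼∇p ⊓ ∼∇c ≤ ∼∇p)]
    rw [key, e', ← key]

/-- If both closed elements lie in F, their meet serves as upper bound and truncates both to itself;
if neither does, their join serves as lower bound. -/
theorem loc_nabla {x y : A} (h : F.mem ∇x ↔ F.mem ∇y) : F.Loc ∇x ∇y := by
  by_cases hx : F.mem ∇x
  · refine ⟨x ⊓ ∇y, ⊥, ?_, ?_, ?_⟩
    · rw [MonadicDeMorganAlgebra.nabla_inf_nabla, F.mem_inf]
      exact ⟨hx, h.1 hx⟩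
    · rw [MonadicDeMorganAlgebra.nabla_bot]
      exact F.not_mem_bot
    · rw [MonadicDeMorganAlgebra.nabla_inf_nabla, inf_left_idem, inf_comm ∇x, inf_left_idem]
  · refine ⟨⊤, x ⊔ y, by rw [nabla_top]; exact F.mem_top, ?_, ?_⟩
    · rw [MonadicDeMorganAlgebra.nabla_sup, F.mem_sup]
      tauto
    · rw [MonadicDeMorganAlgebra.nabla_sup, nabla_top, inf_top_eq, inf_top_eq, sup_left_idem,
        sup_comm ∇x, sup_left_idem]

/-- The congruence of local agreement at `F` and its dual point. -/
def setoid (F : Point A) : Setoid A where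
  r x y := F.Loc x y ∧ F.dual.Loc x y
  iseqv :=
    { refl := fun _ => ⟨.of_eq rfl, .of_eq rfl⟩
      symm := fun h => ⟨h.1.symm, h.2.symm⟩
      trans := fun h h' => ⟨h.1.trans h'.1, h.2.trans h'.2⟩ }

/-- The localization of a monadic De Morgan algebra at a point. -/
def Localization (F : Point A) : Type u := Quotient F.setoid

/-- The canonical map to the localization. -/
def toLocalization (F : Point A) (x : A) : F.Localization := Quotient.mk F.setoid x

theorem toLocalization_surjective (F : Point A) : Function.Surjective F.toLocalization :=
  Quotient.mk_surjective

instance (F : Point A) : Lattice F.Localization :=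
  @Lattice.mk' _
    ⟨Quotient.map₂ (· ⊔ ·) fun _ _ h _ _ h' => ⟨h.1.sup h'.1, h.2.sup h'.2⟩⟩
    ⟨Quotient.map₂ (· ⊓ ·) fun _ _ h _ _ h' => ⟨h.1.inf h'.1, h.2.inf h'.2⟩⟩
    (F.toLocalization_surjective.forall₂.2 fun a b =>
      congrArg F.toLocalization (sup_comm a b))
    (F.toLocalization_surjective.forall₃.2 fun a b c =>
      congrArg F.toLocalization (sup_assoc a b c))
    (F.toLocalization_surjective.forall₂.2 fun a b =>
      congrArg F.toLocalization (inf_comm a b))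
    (F.toLocalization_surjective.forall₃.2 fun a b c =>
      congrArg F.toLocalization (inf_assoc a b c))
    (F.toLocalization_surjective.forall₂.2 fun a b =>
      congrArg F.toLocalization (sup_inf_self (a := a) (b := b)))
    (F.toLocalization_surjective.forall₂.2 fun a b =>
      congrArg F.toLocalization (inf_sup_self (a := a) (b := b)))

theorem toLocalization_sup (F : Point A) (x y : A) :
    F.toLocalization (x ⊔ y) = F.toLocalization x ⊔ F.toLocalization y := rfl

theorem toLocalization_inf (F : Point A) (x y : A) :
    F.toLocalization (x ⊓ y) = F.toLocalization x ⊓ F.toLocalization y := rfl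

theorem toLocalization_mono (F : Point A) {x y : A} (h : x ≤ y) :
    F.toLocalization x ≤ F.toLocalization y := by
  rw [← sup_eq_right, ← toLocalization_sup, sup_eq_right.2 h]

instance (F : Point A) : MonadicDeMorganAlgebra F.Localization where
  le_sup_inf := F.toLocalization_surjective.forall₃.2 fun a b c => by
    simp only [← toLocalization_inf, ← toLocalization_sup]
    exact F.toLocalization_mono le_sup_inf
  top := F.toLocalization ⊤
  bot := F.toLocalization ⊥
  le_top := F.toLocalization_surjective.forall.2 fun a => F.toLocalization_mono le_top
  bot_le := F.toLocalization_surjective.forall.2 fun a => F.toLocalization_mono bot_le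
  neg := Quotient.map DeMorganAlgebra.neg fun _ _ h =>
    ⟨by simpa only [dual_dual] using h.2.compl, h.1.compl⟩
  neg_neg := F.toLocalization_surjective.forall.2 fun a =>
    congrArg F.toLocalization (compl_compl' a)
  neg_sup := F.toLocalization_surjective.forall₂.2 fun a b =>
    congrArg F.toLocalization (compl_sup' a b)
  nabla := Quotient.map MonadicDeMorganAlgebra.nabla fun _ _ h => ⟨h.1.nabla, h.2.nabla⟩
  nabla_bot := congrArg F.toLocalization MonadicDeMorganAlgebra.nabla_bot
  le_nabla := F.toLocalization_surjective.forall.2 fun a =>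
    F.toLocalization_mono (MonadicDeMorganAlgebra.le_nabla a)
  nabla_sup := F.toLocalization_surjective.forall₂.2 fun a b =>
    congrArg F.toLocalization (MonadicDeMorganAlgebra.nabla_sup a b)
  nabla_inf_nabla := F.toLocalization_surjective.forall₂.2 fun a b =>
    congrArg F.toLocalization (MonadicDeMorganAlgebra.nabla_inf_nabla a b)
  nabla_neg_nabla := F.toLocalization_surjective.forall.2 fun a =>
    congrArg F.toLocalization (MonadicDeMorganAlgebra.nabla_neg_nabla a)

/-- The point of the localization that is induced by `F`. -/
def localized (F : Point A) : Point F.Localization where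
  mem := Quotient.lift F.mem fun _ _ h => propext h.1.mem_iff
  mem_top := F.mem_top
  not_mem_bot := F.not_mem_bot
  mem_inf := F.toLocalization_surjective.forall₂.2 F.mem_inf
  mem_sup := F.toLocalization_surjective.forall₂.2 F.mem_sup

/-- A point is generic if, together with its dual, it separates the closed elements. -/
def IsGeneric (F : Point A) : Prop :=
  ∀ x y : A, (F.mem ∇x ↔ F.mem ∇y) → (F.mem ∼∇x ↔ F.mem ∼∇y) → ∇x = ∇y

/-- The hypothesis on negations is agreement at the dual point, so `loc_nabla` applies at both
points. -/
theorem isGeneric_localized (F : Point A) : F.localized.IsGeneric :=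
  F.toLocalization_surjective.forall₂.2 fun _ _ h h' =>
    Quotient.sound ⟨loc_nabla h, loc_nabla (F := F.dual) (not_congr h')⟩

end Point

/-- An algebra is local if it has a generic point: its closed elements form a two-element chain,
a three-element chain, or the four-element De Morgan algebra with two fixed points of `∼`. -/
def Alg.IsLocal (A : Alg.{u}) : Prop := ∃ F : Point A.carrier, F.IsGeneric

/-- The localization of a bundled algebra. -/
def Alg.localization (A : Alg.{u}) (F : Point A.carrier) : Alg.{u} := ⟨F.Localization⟩

theorem Alg.isLocal_localization (A : Alg.{u}) (F : Point A.carrier) :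
    (A.localization F).IsLocal := ⟨F.localized, F.isGeneric_localized⟩

theorem Point.eval_toLocalization {A : Type u} [MonadicDeMorganAlgebra A] (F : Point A)
    (v : ℕ → A) (t : Term) :
    t.eval (fun n => F.toLocalization (v n)) = F.toLocalization (t.eval v) := by
  induction t with
  | var n => rfl
  | zero => rfl
  | one => rfl
  | neg t ih => simp only [Term.eval, ih]; rfl
  | sup s t ihs iht => simp only [Term.eval, ihs, iht]; rfl
  | inf s t ihs iht => simp only [Term.eval, ihs, iht]; rfl
  | nabla t ih => simp only [Term.eval, ih]; rfl

theorem Subvariety.localization_mem {V : Subvariety.{u}} {A : Alg.{u}} (hA : A ∈ V.members)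
    (F : Point A.carrier) : A.localization F ∈ V.members := by
  obtain ⟨E, hE⟩ := V.equational
  rw [hE] at hA ⊢
  intro e he v
  obtain ⟨w, rfl⟩ : ∃ w : ℕ → A.carrier, v = fun n => F.toLocalization (w n) := by
    choose w hw using fun n => F.toLocalization_surjective (v n)
    exact ⟨w, funext fun n => (hw n).symm⟩
  exact (F.eval_toLocalization w _).trans
    ((congrArg _ (hA e he w)).trans (F.eval_toLocalization w _).symm)

/-- Every subvariety is determined by its local members. -/
theorem Subvariety.le_of_local {V W : Subvariety.{u}}
    (h : ∀ A : Alg.{u}, A.IsLocal → A ∈ V.members → A ∈ W.members) : V ≤ W := by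
  intro A hA
  obtain ⟨E, hE⟩ := W.equational
  rw [hE]
  intro e he v
  by_contra hne
  -- Localizing at a point that separates the two values keeps them apart, because membership in F
  -- is constant on congruence classes.
  obtain ⟨F, hF⟩ := Point.exists_ne hne
  have hW := h _ (A.isLocal_localization F) (Subvariety.localization_mem hA F)
  rw [hE] at hW
  have heq := hW e he fun n => F.toLocalization (v n)
  have heq' := (F.eval_toLocalization v _).symm.trans (heq.trans (F.eval_toLocalization v _))
  exact hF (iff_of_eq (congrArg F.localized.mem heq'))

/-- Shift all variables by one. -/
def Term.shift : Term → Term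
  | .var n => .var (n + 1)
  | .zero => .zero
  | .one => .one
  | .neg t => .neg t.shift
  | .sup s t => .sup s.shift t.shift
  | .inf s t => .inf s.shift t.shift
  | .nabla t => .nabla t.shift

theorem Term.eval_shift {A : Type u} [MonadicDeMorganAlgebra A] (v : ℕ → A) (t : Term) :
    t.shift.eval v = t.eval fun n => v (n + 1) := by
  induction t with
  | var n => rfl
  | zero => rfl
  | one => rfl
  | neg t ih => simp only [Term.shift, Term.eval, ih]
  | sup s t ihs iht => simp only [Term.shift, Term.eval, ihs, iht]
  | inf s t ihs iht => simp only [Term.shift, Term.eval, ihs, iht]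
  | nabla t ih => simp only [Term.shift, Term.eval, ih]

/-! ### The basic varieties and their local members -/

section Members

variable {A : Alg.{u}}

theorem mem_varM : A ∈ varM.members := fun _ h => h.elim

theorem mem_varB : A ∈ varB.members ↔
    (∀ x : A.carrier, x ⊓ ∼x = ⊥) ∧ ∀ x : A.carrier, x ⊔ ∼x = ⊤ := by
  constructor
  · exact fun h => ⟨fun x => h eqInfCompl (by simp) fun _ => x,
      fun x => h eqSupCompl (by simp) fun _ => x⟩
  · rintro ⟨h, h'⟩ e (rfl | rfl) v
    · exact h _
    · exact h' _

theorem satisfies_eqKleene : A.Satisfies eqKleene ↔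
    ∀ x y : A.carrier, x ⊓ ∼x ≤ y ⊔ ∼y := by
  constructor
  · intro h x y
    have hxy := h fun n => if n = 0 then x else y
    exact inf_eq_left.1 hxy
  · exact fun h v => inf_eq_left.2 (h _ _)

theorem satisfies_eqZero : A.Satisfies eqZero ↔ ∀ x : A.carrier, ∇x ⊓ ∼∇x = ⊥ :=
  ⟨fun h x => h fun _ => x, fun h _ => h _⟩

theorem satisfies_eqZeroOne : A.Satisfies eqZeroOne ↔
    ∀ x y : A.carrier, ∇x ⊓ ∼∇x ≤ ∇y ⊔ ∼∇y := by
  constructor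
  · intro h x y
    have hxy := h fun n => if n = 0 then x else y
    exact inf_eq_left.1 hxy
  · exact fun h v => inf_eq_left.2 (h _ _)

theorem satisfies_eqTwo : A.Satisfies eqTwo ↔
    ∀ x : A.carrier, ∇(x ⊓ ∼x) ≤ ∼∇(x ⊓ ∼x) :=
  ⟨fun h x => inf_eq_left.1 (h fun _ => x), fun h _ => inf_eq_left.2 (h _)⟩

theorem mem_ofEquations_singleton {e : Equation} :
    A ∈ (ofEquations {e}).members ↔ A.Satisfies e :=
  ⟨fun h => h e rfl, fun h _ he => he ▸ h⟩

theorem mem_ofEquations_pair {e e' : Equation} :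
    A ∈ (ofEquations {e, e'}).members ↔ A.Satisfies e ∧ A.Satisfies e' :=
  ⟨fun h => ⟨h e (Or.inl rfl), h e' (Or.inr rfl)⟩, by rintro ⟨h, h'⟩ _ (rfl | rfl) <;> assumption⟩

theorem mem_varK : A ∈ varK.members ↔ ∀ x y : A.carrier, x ⊓ ∼x ≤ y ⊔ ∼y :=
  mem_ofEquations_singleton.trans satisfies_eqKleene

theorem mem_varM0 : A ∈ varM0.members ↔ ∀ x : A.carrier, ∇x ⊓ ∼∇x = ⊥ :=
  mem_ofEquations_singleton.trans satisfies_eqZero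

theorem mem_varM01 : A ∈ varM01.members ↔ ∀ x y : A.carrier, ∇x ⊓ ∼∇x ≤ ∇y ⊔ ∼∇y :=
  mem_ofEquations_singleton.trans satisfies_eqZeroOne

theorem mem_varM2 : A ∈ varM2.members ↔ ∀ x : A.carrier, ∇(x ⊓ ∼x) ≤ ∼∇(x ⊓ ∼x) :=
  mem_ofEquations_singleton.trans satisfies_eqTwo

theorem mem_varK0 : A ∈ varK0.members ↔ A ∈ varK.members ∧ A ∈ varM0.members :=
  mem_ofEquations_pair.trans
    (and_congr mem_ofEquations_singleton.symm mem_ofEquations_singleton.symm)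

theorem mem_varK1 : A ∈ varK1.members ↔ A ∈ varK.members ∧ A ∈ varM2.members :=
  mem_ofEquations_pair.trans
    (and_congr mem_ofEquations_singleton.symm mem_ofEquations_singleton.symm)

theorem varM01_of_varM0 (h : A ∈ varM0.members) : A ∈ varM01.members :=
  mem_varM01.2 fun x _ => (mem_varM0.1 h x).trans_le bot_le

theorem varM01_of_varK (h : A ∈ varK.members) : A ∈ varM01.members :=
  mem_varM01.2 fun _ _ => mem_varK.1 h _ _

/-- In M2 the closure of z = x ∧ ∼x satisfies ∇z = ∇z ∧ ∼∇z, so the inequality for closed elements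
already yields the Kleene inequality. -/
theorem varK_of_varM01_of_varM2 (h : A ∈ varM01.members) (h' : A ∈ varM2.members) :
    A ∈ varK.members := by
  rw [mem_varM01] at h
  rw [mem_varM2] at h'
  rw [mem_varK]
  intro x y
  calc x ⊓ ∼x ≤ ∇(x ⊓ ∼x) := MonadicDeMorganAlgebra.le_nabla _
    _ = ∇(x ⊓ ∼x) ⊓ ∼∇(x ⊓ ∼x) := (inf_eq_left.2 (h' x)).symm
    _ ≤ ∇(y ⊓ ∼y) ⊔ ∼∇(y ⊓ ∼y) := h _ _
    _ = ∼∇(y ⊓ ∼y) := sup_eq_right.2 (h' y)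
    _ ≤ ∼(y ⊓ ∼y) := compl_antitone (MonadicDeMorganAlgebra.le_nabla _)
    _ = y ⊔ ∼y := by rw [compl_inf', compl_compl', sup_comm]

theorem mem_varB_iff : A ∈ varB.members ↔ A ∈ varM0.members ∧ A ∈ varM2.members := by
  rw [mem_varB, mem_varM0, mem_varM2]
  constructor
  · rintro ⟨h, -⟩
    refine ⟨fun x => h _, fun x => ?_⟩
    rw [h x, MonadicDeMorganAlgebra.nabla_bot]
    exact bot_le
  · rintro ⟨h, h'⟩
    have key : ∀ x : A.carrier, x ⊓ ∼x = ⊥ := fun x => by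
      rw [eq_bot_iff, ← h (x ⊓ ∼x), inf_eq_left.2 (h' x)]
      exact MonadicDeMorganAlgebra.le_nabla _
    refine ⟨key, fun x => ?_⟩
    rw [← compl_bot', ← key x, compl_inf', compl_compl', sup_comm]

theorem Point.IsGeneric.eq {A : Type u} [MonadicDeMorganAlgebra A]
    {F : Point A} (hF : F.IsGeneric) {x y : A} (hx : ∇x = x) (hy : ∇y = y)
    (h : F.mem x ↔ F.mem y) (h' : F.mem ∼x ↔ F.mem ∼y) : x = y := by
  rw [← hx, ← hy] at h h' ⊢
  exact hF x y h h'

/-- In a local algebra, a closed element that is not below its negation is the top. -/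
theorem nabla_eq_top_of_not_le (hA : A.IsLocal) {x : A.carrier} (h : ¬ ∇x ≤ ∼∇x) :
    ∇x = ⊤ := by
  obtain ⟨F, hF⟩ := hA
  have hx : F.mem ∇x ∧ ¬ F.mem ∼∇x := by
    -- Otherwise F and its dual fail to distinguish ∇x ∧ ∼∇x from ∇x, which forces ∇x ≤ ∼∇x.
    by_contra hne
    refine h (inf_eq_left.1 (hF.eq ?_ (nabla_nabla x) ?_ ?_))
    · rw [← MonadicDeMorganAlgebra.nabla_neg_nabla, nabla_nabla_inf_nabla]
    · rw [F.mem_inf]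
      tauto
    · rw [compl_inf', compl_compl', F.mem_sup]
      tauto
  refine hF.eq (nabla_nabla x) (nabla_top _) ?_ ?_
  · exact iff_of_true hx.1 F.mem_top
  · rw [compl_top']
    exact iff_of_false hx.2 F.not_mem_bot

theorem exists_nabla_eq_top (hA : A.IsLocal) (h : A ∉ varM2.members) :
    ∃ x : A.carrier, ∇(x ⊓ ∼x) = ⊤ := by
  rw [mem_varM2, not_forall] at h
  exact h.imp fun _ hx => nabla_eq_top_of_not_le hA hx

theorem varM0_or_varM2_of_varK (hA : A.IsLocal) (h : A ∈ varK.members) :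
    A ∈ varM0.members ∨ A ∈ varM2.members := by
  by_contra! hne
  obtain ⟨x, hx⟩ := exists_nabla_eq_top hA hne.2
  refine hne.1 (mem_varM0.2 fun y => ?_)
  -- The right side of this Kleene inequality is closed, so applying ∇ gives ∇y ∨ ∼∇y = 1; its
  -- negation is the equation of M0.
  have hle := nabla_mono (mem_varK.1 h x ∇y)
  rw [hx, top_le_iff, nabla_sup_compl_nabla] at hle
  rw [← compl_top', ← hle, compl_sup', compl_compl', inf_comm]

end Members

/-! ### Local members of joins -/

/-- `(t ∧ ∇(x ∧ ∼x)) ∨ ∼∇(x ∧ ∼x)`, for a variable `x` that does not occur in `t`. -/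
def Term.relativize (t : Term) : Term :=
  .sup (.inf t.shift (.nabla (.inf (.var 0) (.neg (.var 0)))))
    (.neg (.nabla (.inf (.var 0) (.neg (.var 0)))))

theorem Term.eval_relativize {A : Type u} [MonadicDeMorganAlgebra A] (v : ℕ → A) (t : Term) :
    t.relativize.eval v =
      t.eval (fun n => v (n + 1)) ⊓ ∇(v 0 ⊓ ∼(v 0)) ⊔ ∼∇(v 0 ⊓ ∼(v 0)) := by
  rw [← Term.eval_shift]
  rfl

/-- A local member of a join with `varM2` belongs to one of the two joinands. -/
theorem mem_or_mem_of_mem_sup_varM2 {V : Subvariety.{u}} {A : Alg.{u}} (hA : A.IsLocal)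
    (h : A ∈ (V ⊔ varM2).members) : A ∈ V.members ∨ A ∈ varM2.members := by
  refine or_iff_not_imp_right.2 fun h2 => ?_
  obtain ⟨x, hx⟩ := exists_nabla_eq_top hA h2
  obtain ⟨E, hE⟩ := V.equational
  rw [hE]
  intro e he v
  -- The relativized equation follows from the original one in V; in M2 both sides collapse to ∼∇(x
  -- ∧ ∼x).
  have hle : V ⊔ varM2 ≤ ofEquations {⟨e.lhs.relativize, e.rhs.relativize⟩} := by
    refine sup_le (fun B hB => mem_ofEquations_singleton.2 fun w => ?_)
      (fun B hB => mem_ofEquations_singleton.2 fun w => ?_)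
    · rw [hE] at hB
      simp only [Term.eval_relativize, hB e he _]
    · have hw := mem_varM2.1 hB (w 0)
      simp only [Term.eval_relativize, sup_eq_right.2 (inf_le_right.trans hw)]
  -- Variable 0 receives x and the shifted variables receive v; since ∇(x ∧ ∼x) = 1, the
  -- relativization disappears.
  have key := mem_ofEquations_singleton.1 (hle h) fun n => n.casesOn x v
  rw [Term.eval_relativize, Term.eval_relativize] at key
  change e.lhs.eval v ⊓ ∇(x ⊓ ∼x) ⊔ ∼∇(x ⊓ ∼x) = e.rhs.eval v ⊓ ∇(x ⊓ ∼x) ⊔ ∼∇(x ⊓ ∼x) at key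
  rwa [hx, compl_top', inf_top_eq, inf_top_eq, sup_bot_eq, sup_bot_eq] at key

theorem mem_sup_varM2 {V : Subvariety.{u}} {A : Alg.{u}} (hA : A.IsLocal) :
    A ∈ (V ⊔ varM2).members ↔ A ∈ V.members ∨ A ∈ varM2.members :=
  ⟨mem_or_mem_of_mem_sup_varM2 hA, fun h => h.elim
    (fun h => (le_sup_left : V ≤ V ⊔ varM2) h) (fun h => (le_sup_right : varM2 ≤ V ⊔ varM2) h)⟩

theorem varK_le_varM0_sup_varM2 : varK.{u} ≤ varM0 ⊔ varM2 :=
  Subvariety.le_of_local fun _ hA h => (mem_sup_varM2 hA).2 (varM0_or_varM2_of_varK hA h)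

/-- The join lies below M01 and below M0 ∨ M2; a local member outside M0 is thus in M01 ∩ M2 ⊆ K. -/
theorem mem_varM0_sup_varK {A : Alg.{u}} (hA : A.IsLocal) :
    A ∈ (varM0 ⊔ varK).members ↔ A ∈ varM0.members ∨ A ∈ varK.members := by
  constructor
  · intro h
    have h01 : A ∈ varM01.members :=
      (sup_le (fun _ => varM01_of_varM0) (fun _ => varM01_of_varK) : varM0 ⊔ varK ≤ varM01) h
    have h02 : A ∈ (varM0 ⊔ varM2).members :=
      (sup_le le_sup_left varK_le_varM0_sup_varM2 : varM0 ⊔ varK ≤ varM0 ⊔ varM2) h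
    exact ((mem_sup_varM2 hA).1 h02).imp_right (varK_of_varM01_of_varM2 h01)
  · exact fun h => h.elim (fun h => (le_sup_left : varM0 ≤ varM0 ⊔ varK) h)
      (fun h => (le_sup_right : varK ≤ varM0 ⊔ varK) h)

/-! ### The diagram as a family of finite sets -/

section Profiles

/-- The types of local algebras that belong to the variety at a node. -/
def profile : Node → Finset (Fin 7)
  | .B => {0}
  | .K0 => {0, 1}
  | .K1 => {0, 3}
  | .K => {0, 1, 3}
  | .M0 => {0, 1, 2}
  | .M2 => {0, 3, 5}
  | .M0K => {0, 1, 2, 3}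
  | .KM2 => {0, 1, 3, 5}
  | .M01 => {0, 1, 2, 3, 4}
  | .M0M2 => {0, 1, 2, 3, 5}
  | .M01M2 => {0, 1, 2, 3, 4, 5}
  | .M => {0, 1, 2, 3, 4, 5, 6}

theorem Node.ctorIdx_injective : Function.Injective Node.ctorIdx := fun i j h => by
  cases i <;> cases j <;> first | rfl | exact absurd h (by decide)

instance : DecidableEq Node := Node.ctorIdx_injective.decidableEq

instance : Fintype Node :=
  ⟨{.B, .K0, .K1, .K, .M0, .M2, .M0K, .KM2, .M01, .M0M2, .M01M2, .M},
    fun i => by cases i <;> decide⟩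

theorem profile_injective : Function.Injective profile := by
  intro i j
  revert i j
  decide

instance : PartialOrder Node := PartialOrder.lift profile profile_injective

instance : DecidableLE Node := fun i j => inferInstanceAs (Decidable (profile i ⊆ profile j))

instance : DecidableLT Node := fun i j => decidable_of_iff (i ≤ j ∧ ¬ j ≤ i) lt_iff_le_not_ge.symm

instance : LocallyFiniteOrder Node := Fintype.toLocallyFiniteOrder

instance : DecidableRel Edge := fun i j =>
  decidable_of_iff ((i, j) ∈ ([(.B, .K0), (.B, .K1), (.K0, .M0), (.K0, .K), (.K1, .K), (.K1, .M2),
    (.M0, .M0K), (.K, .M0K), (.K, .KM2), (.M2, .KM2), (.M0K, .M01), (.M0K, .M0M2), (.KM2, .M0M2),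
    (.M01, .M01M2), (.M0M2, .M01M2), (.M01M2, .M)] : List (Node × Node))) <| by
    constructor
    · intro h
      simp only [List.mem_cons, Prod.mk.injEq, List.not_mem_nil, or_false] at h
      rcases h with h | h | h | h | h | h | h | h | h | h | h | h | h | h | h | h <;>
      · obtain ⟨rfl, rfl⟩ := h
        constructor
    · intro h
      cases h <;> decide

theorem Node.covBy_iff_edge (i j : Node) : i ⋖ j ↔ Edge i j := by
  have key : ∀ i j : Node, (i < j ∧ ∀ k, i < k → ¬ k < j) ↔ Edge i j := by decide +kernel
  exact (and_congr_right fun _ => ⟨fun h k => @h k, fun h k => h k⟩).trans (key i j)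

theorem exists_profile_union (i j : Node) : ∃ k, profile k = profile i ∪ profile j := by
  revert i j
  decide +kernel

theorem exists_profile_inter (i j : Node) : ∃ k, profile k = profile i ∩ profile j := by
  revert i j
  decide +kernel

end Profiles

/-! ### Types of local algebras -/

/-- An algebra has type `t` if it belongs to the varieties at the nodes whose profile has `t`. -/
def Alg.HasType (A : Alg.{u}) (t : Fin 7) : Prop :=
  ∀ i, A ∈ (label.{u} i).members ↔ t ∈ profile i

theorem Alg.IsLocal.hasType {A : Alg.{u}} (hA : A.IsLocal) {t : Fin 7}
    (h0 : A ∈ varM0.members ↔ t ∈ profile .M0) (h01 : A ∈ varM01.members ↔ t ∈ profile .M01)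
    (hK : A ∈ varK.members ↔ t ∈ profile .K) (h2 : A ∈ varM2.members ↔ t ∈ profile .M2) :
    A.HasType t := by
  intro i
  cases i <;> simp only [label]
  · rw [mem_varB_iff, h0, h2]; clear h0 h01 hK h2; revert t; decide
  · rw [mem_varK0, hK, h0]; clear h0 h01 hK h2; revert t; decide
  · rw [mem_varK1, hK, h2]; clear h0 h01 hK h2; revert t; decide
  · exact hK
  · exact h0
  · exact h2
  · rw [mem_varM0_sup_varK hA, h0, hK]; clear h0 h01 hK h2; revert t; decide
  · rw [mem_sup_varM2 hA, hK, h2]; clear h0 h01 hK h2; revert t; decide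
  · exact h01
  · rw [mem_sup_varM2 hA, h0, h2]; clear h0 h01 hK h2; revert t; decide
  · rw [mem_sup_varM2 hA, h01, h2]; clear h0 h01 hK h2; revert t; decide
  · exact iff_of_true mem_varM (by clear h0 h01 hK h2; revert t; decide)

/-- Of the sixteen truth patterns for M0, M01, K and M2, exactly seven satisfy the implications `e1`
to `e4`, one for each type. -/
theorem Alg.IsLocal.exists_hasType {A : Alg.{u}} (hA : A.IsLocal) : ∃ t, A.HasType t := by
  suffices ∃ t, (A ∈ varM0.members ↔ t ∈ profile .M0) ∧ (A ∈ varM01.members ↔ t ∈ profile .M01) ∧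
      (A ∈ varK.members ↔ t ∈ profile .K) ∧ (A ∈ varM2.members ↔ t ∈ profile .M2) by
    obtain ⟨t, h0, h01, hK, h2⟩ := this
    exact ⟨t, hA.hasType h0 h01 hK h2⟩
  have e1 : A ∈ varM0.members → A ∈ varM01.members := varM01_of_varM0
  have e2 : A ∈ varK.members → A ∈ varM01.members := varM01_of_varK
  have e3 : A ∈ varM01.members → A ∈ varM2.members → A ∈ varK.members := varK_of_varM01_of_varM2
  have e4 : A ∈ varK.members → A ∈ varM0.members ∨ A ∈ varM2.members := varM0_or_varM2_of_varK hA
  generalize (A ∈ varM0.members) = m0 at *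
  generalize (A ∈ varM01.members) = m01 at *
  generalize (A ∈ varK.members) = k at *
  generalize (A ∈ varM2.members) = m2 at *
  by_cases m0 <;> by_cases m01 <;> by_cases k <;> by_cases m2 <;> simp_all <;> decide

/-! ### Local algebras realizing the seven types -/

section Examples

/-- The two-element De Morgan algebra. -/
def Two : Type u := Set PUnit.{u + 1}

instance : DeMorganAlgebra Two.{u} :=
  { (inferInstance : DistribLattice (Set PUnit.{u + 1})),
    (inferInstance : BoundedOrder (Set PUnit.{u + 1})) with
    neg := (compl : Set PUnit → Set PUnit)
    neg_neg := fun s : Set PUnit => compl_compl s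
    neg_sup := fun s t => compl_sup (α := Set PUnit.{u + 1}) (a := s) (b := t) }

namespace Two

/-- The only point of the two-element algebra. -/
def point : Point Two.{u} where
  mem s := Membership.mem (γ := Set PUnit.{u + 1}) s PUnit.unit
  mem_top := trivial
  not_mem_bot := id
  mem_inf _ _ := Iff.rfl
  mem_sup _ _ := Iff.rfl

theorem ext {x y : Two.{u}} (h : point.mem x ↔ point.mem y) : x = y :=
  Set.ext fun _ => h

theorem inf_compl (x : Two.{u}) : x ⊓ ∼x = ⊥ := inf_compl_self (α := Set PUnit) x

theorem sup_compl (x : Two.{u}) : x ⊔ ∼x = ⊤ := sup_compl_eq_top (α := Set PUnit) (x := x)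

theorem bot_ne_top : (⊥ : Two.{u}) ≠ ⊤ := fun h =>
  point.not_mem_bot (h ▸ point.mem_top)

end Two

/-- The square of a De Morgan algebra, with `∼(x, y) = (∼y, ∼x)`. -/
def Exch (D : Type u) : Type u := D × D

instance (D : Type u) [DeMorganAlgebra D] : DeMorganAlgebra (Exch D) :=
  { (inferInstance : DistribLattice (D × D)), (inferInstance : BoundedOrder (D × D)) with
    neg := fun p => (∼p.2, ∼p.1)
    neg_neg := fun p => Prod.ext (compl_compl' p.1) (compl_compl' p.2)
    neg_sup := fun p q => Prod.ext (compl_sup' p.2 q.2) (compl_sup' p.1 q.1) }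

/-- The sublattice of pairs `(x, y)` with `x ≤ y`. -/
def increasingPairs : Sublattice (Two.{u} × Two.{u}) where
  carrier := {p | p.1 ≤ p.2}
  supClosed' _ hp _ hq := by
    simp only [Set.mem_ofPred_eq] at hp hq
    exact sup_le_sup hp hq
  infClosed' _ hp _ hq := by
    simp only [Set.mem_ofPred_eq] at hp hq
    exact inf_le_inf hp hq

/-- The three-element De Morgan algebra, as the algebra of pairs `(x, y)` with `x ≤ y`. -/
def Three : Type u := increasingPairs.{u}

instance : DeMorganAlgebra Three.{u} :=
  { (inferInstance : DistribLattice increasingPairs.{u}) with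
    top := ⟨⊤, show (⊤ : Two) ≤ ⊤ from le_rfl⟩
    bot := ⟨⊥, show (⊥ : Two) ≤ ⊥ from le_rfl⟩
    le_top := fun p => (le_top : p.1 ≤ ⊤)
    bot_le := fun p => (bot_le : ⊥ ≤ p.1)
    neg := fun p => ⟨(∼p.1.2, ∼p.1.1), compl_antitone (show p.1.1 ≤ p.1.2 from p.2)⟩
    neg_neg := fun p => Subtype.ext (Prod.ext (compl_compl' p.1.1) (compl_compl' p.1.2))
    neg_sup := fun p q =>
      Subtype.ext (Prod.ext (compl_sup' p.1.2 q.1.2) (compl_sup' p.1.1 q.1.1)) }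

/-- The middle element of the three-element algebra. -/
def Three.mid : Three.{u} := ⟨(⊥, ⊤), show (⊥ : Two) ≤ ⊤ from bot_le⟩

theorem Three.mid_inf_compl : Three.mid.{u} ⊓ ∼Three.mid ≠ ⊥ := fun h => by
  have h' : (⊤ : Two.{u}) ⊓ ∼⊥ = ⊥ := congrArg (fun p : Three.{u} => p.1.2) h
  rw [compl_bot', inf_top_eq] at h'
  exact Two.bot_ne_top h'.symm

theorem Three.kleene (x y : Three.{u}) : x ⊓ ∼x ≤ y ⊔ ∼y := by
  constructor
  · change x.1.1 ⊓ ∼x.1.2 ≤ y.1.1 ⊔ ∼y.1.2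
    refine le_trans ?_ bot_le
    rw [← Two.inf_compl x.1.2]
    exact inf_le_inf_right _ x.2
  · change x.1.2 ⊓ ∼x.1.1 ≤ y.1.2 ⊔ ∼y.1.1
    refine le_trans le_top ?_
    rw [← Two.sup_compl y.1.1]
    exact sup_le_sup_right y.2 _

namespace Point

/-- A point separates a De Morgan algebra if, together with its dual, it separates elements. -/
def Separates {D : Type u} [DeMorganAlgebra D] (G : Point D) : Prop :=
  ∀ x y : D, (G.mem x ↔ G.mem y) → (G.mem ∼x ↔ G.mem ∼y) → x = y

theorem separates_two : Two.point.{u}.Separates := fun _ _ h _ => Two.ext h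

/-- The first projection of the three-element algebra, as a point. -/
def three : Point Three.{u} where
  mem p := Two.point.{u}.mem p.1.1
  mem_top := Two.point.{u}.mem_top
  not_mem_bot := Two.point.{u}.not_mem_bot
  mem_inf p q := Two.point.{u}.mem_inf p.1.1 q.1.1
  mem_sup p q := Two.point.{u}.mem_sup p.1.1 q.1.1

/-- The first coordinate of ∼p is the negation of the second coordinate of p, so one point reads off
both coordinates. -/
theorem separates_three : three.{u}.Separates := fun _ _ h h' =>
  Subtype.ext (Prod.ext (Two.ext h) (Two.ext (not_iff_not.1 h')))

/-- The point of the exchange square whose membership is that of the first coordinate. -/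
def exch {D : Type u} [DeMorganAlgebra D] (G : Point D) : Point (Exch D) where
  mem p := G.mem p.1
  mem_top := G.mem_top
  not_mem_bot := G.not_mem_bot
  mem_inf p q := G.mem_inf p.1 q.1
  mem_sup p q := G.mem_sup p.1 q.1

theorem separates_exch_two : Two.point.{u}.exch.Separates := fun _ _ h h' =>
  Prod.ext (Two.ext h) (Two.ext (not_iff_not.1 h'))

end Point

/-- A De Morgan algebra with the identity as quantifier. -/
def discrete (D : Type u) [DeMorganAlgebra D] : Alg.{u} :=
  { carrier := D
    str :=
      { nabla := id
        nabla_bot := rfl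
        le_nabla := fun _ => le_rfl
        nabla_sup := fun _ _ => rfl
        nabla_inf_nabla := fun _ _ => rfl
        nabla_neg_nabla := fun _ => rfl } }

/-- The exchange square of a De Morgan algebra with `∇(x, y) = (x ∨ y, x ∨ y)`. -/
def exchange (D : Type u) [DeMorganAlgebra D] : Alg.{u} :=
  { carrier := Exch D
    str :=
      { nabla := fun p => (p.1 ⊔ p.2, p.1 ⊔ p.2)
        nabla_bot := Prod.ext (sup_idem (⊥ : D)) (sup_idem (⊥ : D))
        le_nabla := fun p => ⟨(le_sup_left : p.1 ≤ p.1 ⊔ p.2), (le_sup_right : p.2 ≤ p.1 ⊔ p.2)⟩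
        nabla_sup := fun p q => Prod.ext (sup_sup_sup_comm p.1 q.1 p.2 q.2)
          (sup_sup_sup_comm p.1 q.1 p.2 q.2)
        nabla_inf_nabla := fun p q => Prod.ext (inf_sup_right p.1 p.2 (q.1 ⊔ q.2)).symm
          (inf_sup_right p.1 p.2 (q.1 ⊔ q.2)).symm
        nabla_neg_nabla := fun p => Prod.ext (sup_idem ∼(p.1 ⊔ p.2)) (sup_idem ∼(p.1 ⊔ p.2)) } }

/-- The three-element De Morgan algebra with two-element set of closed elements. -/
def simpleThree : Alg.{u} :=
  { carrier := Three.{u}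
    str :=
      { nabla := fun p => ⟨(p.1.2, p.1.2), show p.1.2 ≤ p.1.2 from le_rfl⟩
        nabla_bot := rfl
        le_nabla := fun p => ⟨p.2, le_rfl⟩
        nabla_sup := fun _ _ => rfl
        nabla_inf_nabla := fun _ _ => rfl
        nabla_neg_nabla := fun _ => rfl } }

variable {D : Type u} [DeMorganAlgebra D]

theorem isLocal_discrete {G : Point D} (hG : G.Separates) : (discrete D).IsLocal := ⟨G, hG⟩

theorem isLocal_exchange {G : Point D} (hG : G.Separates) : (exchange D).IsLocal :=
  ⟨G.exch, fun p q h h' => by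
    have key : p.1 ⊔ p.2 = q.1 ⊔ q.2 := hG _ _ h h'
    exact Prod.ext key key⟩

theorem isLocal_simpleThree : simpleThree.{u}.IsLocal :=
  ⟨Point.three, fun p q h _ => by
    have key : p.1.2 = q.1.2 := Two.ext h
    exact Subtype.ext (Prod.ext key key)⟩

theorem discrete_mem_varM2 : discrete D ∈ varM2.members :=
  mem_varM2.2 fun x => by
    change x ⊓ ∼x ≤ ∼(x ⊓ ∼x)
    rw [compl_inf', compl_compl']
    exact inf_le_right.trans le_sup_left

theorem discrete_mem_varM0 : discrete D ∈ varM0.members ↔ ∀ x : D, x ⊓ ∼x = ⊥ := mem_varM0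

theorem discrete_mem_varM01 :
    discrete D ∈ varM01.members ↔ ∀ x y : D, x ⊓ ∼x ≤ y ⊔ ∼y := mem_varM01

theorem exchange_mem_varM0 : exchange D ∈ varM0.members ↔ ∀ x : D, x ⊓ ∼x = ⊥ := by
  rw [mem_varM0]
  constructor
  · intro h x
    have hx : (x ⊔ x) ⊓ ∼(x ⊔ x) = ⊥ := congrArg Prod.fst (h (x, x))
    rwa [sup_idem] at hx
  · exact fun h p => Prod.ext (h (p.1 ⊔ p.2)) (h (p.1 ⊔ p.2))

theorem exchange_mem_varM01 :
    exchange D ∈ varM01.members ↔ ∀ x y : D, x ⊓ ∼x ≤ y ⊔ ∼y := by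
  rw [mem_varM01]
  constructor
  · intro h x y
    have hx : (x ⊔ x) ⊓ ∼(x ⊔ x) ≤ (y ⊔ y) ⊔ ∼(y ⊔ y) := (h (x, x) (y, y)).1
    rwa [sup_idem, sup_idem] at hx
  · exact fun h p q => ⟨h (p.1 ⊔ p.2) (q.1 ⊔ q.2), h (p.1 ⊔ p.2) (q.1 ⊔ q.2)⟩

/-- The pairs (1, 0) and (0, 1) are both fixed by ∼, and are incomparable when 0 ≠ 1. -/
theorem exchange_notMem_varK (hD : (⊥ : D) ≠ ⊤) : exchange D ∉ varK.members := fun h => by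
  have key : (⊤ : D) ⊓ ∼⊥ ≤ ⊥ ⊔ ∼⊤ := (mem_varK.1 h (⊤, ⊥) (⊥, ⊤)).1
  rw [compl_bot', compl_top', inf_idem, sup_idem, top_le_iff] at key
  exact hD key

/-- The pair (1, 0) is fixed by ∼ and its closure is 1. -/
theorem exchange_notMem_varM2 (hD : (⊥ : D) ≠ ⊤) : exchange D ∉ varM2.members := fun h => by
  have key : ((⊤ : D) ⊓ ∼⊥) ⊔ (⊥ ⊓ ∼⊤) ≤ ∼(((⊤ : D) ⊓ ∼⊥) ⊔ (⊥ ⊓ ∼⊤)) :=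
    (mem_varM2.1 h (⊤, ⊥)).1
  rw [compl_bot', compl_top', inf_idem, inf_idem, sup_bot_eq, compl_top', top_le_iff] at key
  exact hD key

theorem exch_two_not_kleene : ¬ ∀ x y : Exch Two.{u}, x ⊓ ∼x ≤ y ⊔ ∼y := fun h => by
  have key : (⊤ : Two.{u}) ⊓ ∼⊥ ≤ ⊥ ⊔ ∼⊤ := (h (⊤, ⊥) (⊥, ⊤)).1
  rw [compl_bot', compl_top', inf_idem, sup_idem, top_le_iff] at key
  exact Two.bot_ne_top key

theorem Point.bot_ne_top (G : Point D) : (⊥ : D) ≠ ⊤ := fun h => G.not_mem_bot (h ▸ G.mem_top)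

theorem simpleThree_mem_varM0 : simpleThree.{u} ∈ varM0.members :=
  mem_varM0.2 fun p =>
    Subtype.ext (Prod.ext (Two.inf_compl p.1.2) (Two.inf_compl p.1.2))

theorem simpleThree_mem_varK : simpleThree.{u} ∈ varK.members := mem_varK.2 Three.kleene

theorem simpleThree_notMem_varM2 : simpleThree.{u} ∉ varM2.members := fun h => by
  have key : (⊤ : Two.{u}) ⊓ ∼⊥ ≤ ∼(⊤ ⊓ ∼⊥) := (mem_varM2.1 h Three.mid).1
  rw [compl_bot', inf_idem, compl_top', top_le_iff] at key
  exact Two.bot_ne_top key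

/-- Membership in M0 and M01 depends only on the closed elements, which form a copy of D in both
`discrete D` and `exchange D`. The former always lies in M2; the latter, for D nontrivial, lies in
neither K nor M2. Taking D with two, three or four elements gives all types but 1, which
`simpleThree` supplies. -/
theorem exists_hasType (t : Fin 7) : ∃ A : Alg.{u}, A.HasType t := by
  have hT : (⊥ : Three.{u}) ≠ ⊤ := Point.three.bot_ne_top
  have hE : (⊥ : Exch Two.{u}) ≠ ⊤ := Two.point.exch.bot_ne_top
  have not0 : ∀ {A : Alg.{u}}, A ∉ varM01.members → A ∉ varM0.members :=
    fun h h' => h (varM01_of_varM0 h')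
  have notK : ∀ {A : Alg.{u}}, A ∉ varM01.members → A ∉ varK.members :=
    fun h h' => h (varM01_of_varK h')
  have h0 := discrete_mem_varM0.{u}.2 Two.inf_compl
  have h3 : discrete Three.{u} ∈ varM01.members := discrete_mem_varM01.2 Three.kleene
  have h5 := mt discrete_mem_varM01.1 exch_two_not_kleene.{u}
  have h6 := mt exchange_mem_varM01.1 exch_two_not_kleene.{u}
  have h2 := exchange_mem_varM0.{u}.2 Two.inf_compl
  fin_cases t
  · refine ⟨discrete Two.{u}, (isLocal_discrete Point.separates_two).hasType
      (iff_of_true h0 (by decide)) (iff_of_true (varM01_of_varM0 h0) (by decide))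
      (iff_of_true (varK_of_varM01_of_varM2 (varM01_of_varM0 h0) discrete_mem_varM2) (by decide))
      (iff_of_true discrete_mem_varM2 (by decide))⟩
  · refine ⟨simpleThree.{u}, isLocal_simpleThree.hasType
      (iff_of_true simpleThree_mem_varM0 (by decide))
      (iff_of_true (varM01_of_varM0 simpleThree_mem_varM0) (by decide))
      (iff_of_true simpleThree_mem_varK (by decide))
      (iff_of_false simpleThree_notMem_varM2 (by decide))⟩
  · refine ⟨exchange Two.{u}, (isLocal_exchange Point.separates_two).hasType
      (iff_of_true h2 (by decide)) (iff_of_true (varM01_of_varM0 h2) (by decide))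
      (iff_of_false (exchange_notMem_varK Two.bot_ne_top) (by decide))
      (iff_of_false (exchange_notMem_varM2 Two.bot_ne_top) (by decide))⟩
  · refine ⟨discrete Three.{u}, (isLocal_discrete Point.separates_three).hasType
      (iff_of_false (fun h => Three.mid_inf_compl (discrete_mem_varM0.1 h _)) (by decide))
      (iff_of_true h3 (by decide))
      (iff_of_true (varK_of_varM01_of_varM2 h3 discrete_mem_varM2) (by decide))
      (iff_of_true discrete_mem_varM2 (by decide))⟩
  · refine ⟨exchange Three.{u}, (isLocal_exchange Point.separates_three).hasType
      (iff_of_false (fun h => Three.mid_inf_compl (exchange_mem_varM0.1 h _)) (by decide))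
      (iff_of_true (exchange_mem_varM01.2 Three.kleene) (by decide))
      (iff_of_false (exchange_notMem_varK hT) (by decide))
      (iff_of_false (exchange_notMem_varM2 hT) (by decide))⟩
  · refine ⟨discrete (Exch Two.{u}), (isLocal_discrete Point.separates_exch_two).hasType
      (iff_of_false (not0 h5) (by decide)) (iff_of_false h5 (by decide))
      (iff_of_false (notK h5) (by decide)) (iff_of_true discrete_mem_varM2 (by decide))⟩
  · refine ⟨exchange (Exch Two.{u}), (isLocal_exchange Point.separates_exch_two).hasType
      (iff_of_false (not0 h6) (by decide)) (iff_of_false h6 (by decide))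
      (iff_of_false (notK h6) (by decide))
      (iff_of_false (exchange_notMem_varM2 hE) (by decide))⟩

end Examples

/-! ### Transfer from profiles to subvarieties -/

/-- The realizing algebras detect each missing inclusion, while local members suffice to prove each
inclusion that holds. -/
theorem label_le_label_iff {i j : Node} : label.{u} i ≤ label j ↔ i ≤ j := by
  constructor
  · intro h t ht
    obtain ⟨A, hA⟩ := exists_hasType.{u} t
    exact (hA j).1 (h ((hA i).2 ht))
  · refine fun h => Subvariety.le_of_local fun A hA hi => ?_
    obtain ⟨t, ht⟩ := hA.exists_hasType
    exact (ht j).2 (h ((ht i).1 hi))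

theorem label_sup_label {i j k : Node} (h : profile k = profile i ∪ profile j) :
    label.{u} i ⊔ label j = label k := by
  apply le_antisymm
  · refine sup_le (label_le_label_iff.2 ?_) (label_le_label_iff.2 ?_)
    · exact Finset.subset_union_left.trans h.ge
    · exact Finset.subset_union_right.trans h.ge
  · refine Subvariety.le_of_local fun A hA hk => ?_
    obtain ⟨t, ht⟩ := hA.exists_hasType
    have hmem := (ht k).1 hk
    rw [h, Finset.mem_union, ← ht i, ← ht j] at hmem
    exact hmem.elim (fun hi => (le_sup_left : label i ≤ label i ⊔ label j) hi)
      (fun hj => (le_sup_right : label j ≤ label i ⊔ label j) hj)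

theorem label_inf_label {i j k : Node} (h : profile k = profile i ∩ profile j) :
    label.{u} i ⊓ label j = label k := by
  apply le_antisymm
  · refine Subvariety.le_of_local fun A hA hmem => ?_
    obtain ⟨t, ht⟩ := hA.exists_hasType
    rw [ht k, h, Finset.mem_inter, ← ht i, ← ht j]
    exact ⟨(inf_le_left : label i ⊓ label j ≤ label i) hmem,
      (inf_le_right : label i ⊓ label j ≤ label j) hmem⟩
  · refine le_inf (label_le_label_iff.2 ?_) (label_le_label_iff.2 ?_)
    · exact h.le.trans Finset.inter_subset_left
    · exact h.le.trans Finset.inter_subset_right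

/-- The labels, as an order embedding of the diagram into the lattice of subvarieties. -/
def labelEmbedding : Node ↪o Subvariety.{u} := OrderEmbedding.ofMapLEIff label fun _ _ =>
  label_le_label_iff

/-- The sublattice formed by the labels. -/
def labelSublattice : Sublattice Subvariety.{u} where
  carrier := Set.range labelEmbedding.{u}
  supClosed' := by
    rintro _ ⟨i, rfl⟩ _ ⟨j, rfl⟩
    exact (exists_profile_union i j).imp fun _ h => (label_sup_label h).symm
  infClosed' := by
    rintro _ ⟨i, rfl⟩ _ ⟨j, rfl⟩
    exact (exists_profile_inter i j).imp fun _ h => (label_inf_label h).symm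

end MonadicDeMorgan

theorem mainTheorem5 :
    ∃ (S : Sublattice MonadicDeMorgan.Subvariety.{u}) (e : MonadicDeMorgan.Node ≃ S),
      (∀ i, (e i : MonadicDeMorgan.Subvariety.{u}) = MonadicDeMorgan.label i) ∧
      (∀ i j, e i ≤ e j ↔ Relation.ReflTransGen MonadicDeMorgan.Edge i j) ∧
      (∀ i j, e i ⋖ e j ↔ MonadicDeMorgan.Edge i j) := by
  let e : MonadicDeMorgan.Node ≃o MonadicDeMorgan.labelSublattice.{u} :=
    MonadicDeMorgan.labelEmbedding.orderIso
  refine ⟨MonadicDeMorgan.labelSublattice, e.toEquiv, fun _ => rfl, fun i j => ?_, fun i j => ?_⟩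
  · rw [← show (fun i j : MonadicDeMorgan.Node => i ⋖ j) = MonadicDeMorgan.Edge from
      funext₂ fun i j => propext (MonadicDeMorgan.Node.covBy_iff_edge i j)]
    exact e.le_iff_le.trans le_iff_reflTransGen_covBy
  · exact (apply_covBy_apply_iff e).trans (MonadicDeMorgan.Node.covBy_iff_edge i j)
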